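/- Let $K$ be a commutative ring, let $A,B$ be associative unital $K$-algebras, and let $\varphi : B\to A$ be a unit-preserving $K$-algebra homomorphism, not necessarily injective (an algebra extension, written $A\,\|\,B$). It is called right D2 (resp. left D2) if $A\otimes_B A$, as an $A$-$B$-bimodule (resp. $B$-$A$-bimodule), is isomorphic to a direct summand of a finite direct sum of copies of the natural $A$-$B$-bimodule (resp. $B$-$A$-bimodule) $A$. Let $S=\operatorname{End}({}_BA_B)$ and $T=(A\otimes_BA)^B=\{t: bt=tb\ \forall b\in B\}$. A right D2 quasibase of $A\,\|\,B$ consists of finitely many $\gamma_j\in S$, $u_j\in T$ with $a\otimes_B a'=\sum_j a\gamma_j(a')u_j$ for all $a,a'\in A$; a left D2 quasibase consists of finitely many $\beta_i\in S$, $t_i\in T$ with $a\otimes_B a'=\sum_i t_i\beta_i(a)a'$ for all $a,a'\in A$. The extension is left balanced if every endomorphism of $A$ as a module over $\operatorname{End}({}_BA)$ is left multiplication by (the image of) an element of $B$. Let $\mathcal E=\operatorname{End}({}_BA)$, with composition as multiplication, and let $\rho:A^{\rm op}\to\mathcal E$, $\rho(a)(x)=xa$, be the left endomorphism extension $\mathcal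 E\,\|\,A^{\rm op}$. Suppose that $A\,\|\,B$ is right D2. Then: 1. $\rho$ is injective, and the extension $\mathcal E\,\|\,A^{\rm op}$ is left D2 and left balanced. 2. $A\,\|\,B$ has a right D2 quasibase, and for every right D2 quasibase $(\gamma_j,u_j)_j$ of $A\,\|\,B$, writing $u_j=u_j^1\otimes u_j^2$ (summation suppressed), the elements $$T_j:=\sum_k \gamma_j(-\,u_k^1)\,u_k^2\otimes_{\rho(A)}\gamma_k\ \in\ (\mathcal E\otimes_{\rho(A)}\mathcal E)^{\rho(A)},\qquad \mathcal B_j\in\operatorname{End}({}_{\rho(A)}\mathcal E_{\rho(A)}),\quad \mathcal B_j(f):=u_j^1\,f(u_j^2\,-),$$ form a left D2 quasibase of $\mathcal E\,\|\,A^{\rm op}$, that is, the $T_j$ and $\mathcal B_j$ lie in the sets indicated and $f\otimes_{\rho(A)} g=\sum_j T_j\,\mathcal B_j(f)\,g$ for all $f,g\in\mathcal E$. -/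

import Mathlib

open scoped TensorProduct
open MulOpposite

noncomputable section

namespace DepthTwo

/-- A `K`-symmetric `A`-`B`-bimodule structure on the `K`-module `M`: a left action of `A` and a right
action of `B` (that is, a left action of the opposite algebra) by `K`-linear maps, which commute. -/
structure Bimod (K A B M : Type*) [CommRing K] [Ring A] [Ring B] [Algebra K A] [Algebra K B]
    [AddCommGroup M] [Module K M] where
  left : A →ₐ[K] Module.End K M
  right : Bᵐᵒᵖ →ₐ[K] Module.End K M
  comm : ∀ a b m, left a (right b m) = right b (left a m)

namespace Bimod

/-- The natural `A`-`A`-bimodule `A`. -/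
def regular (K A : Type*) [CommRing K] [Ring A] [Algebra K A] : Bimod K A A A where
  left := Algebra.lmul K A
  right := AlgHom.ofLinearMap
    ((LinearMap.mul K A).flip ∘ₗ (opLinearEquiv K).symm.toLinearMap)
    (by ext x; simp)
    (by intro a b; ext x; simp [mul_assoc])
  comm := by intro a b m; simp [mul_assoc]

section Basic

variable {K A A' B B' C M N : Type*} [CommRing K] [Ring A] [Ring A'] [Ring B] [Ring B'] [Ring C]
  [Algebra K A] [Algebra K A'] [Algebra K B] [Algebra K B'] [Algebra K C]
  [AddCommGroup M] [Module K M] [AddCommGroup N] [Module K N]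

/-- Restriction of scalars on both sides. -/
def restrict (X : Bimod K A B M) (φ : A' →ₐ[K] A) (ψ : B' →ₐ[K] B) : Bimod K A' B' M where
  left := X.left.comp φ
  right := X.right.comp (AlgHom.op ψ)
  comm := fun _ _ _ => X.comm _ _ _

/-- The direct sum of `n` copies of a bimodule. -/
def pow (X : Bimod K A B M) (n : ℕ) : Bimod K A B (Fin n → M) where
  left := AlgHom.ofLinearMap
    { toFun := fun a => LinearMap.pi fun i => X.left a ∘ₗ LinearMap.proj i
      map_add' := by intro a b; ext; simp
      map_smul' := by intro a b; ext; simp }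
    (by ext; simp) (by intro a b; ext; simp)
  right := AlgHom.ofLinearMap
    { toFun := fun b => LinearMap.pi fun i => X.right b ∘ₗ LinearMap.proj i
      map_add' := by intro a b; ext; simp
      map_smul' := by intro a b; ext; simp }
    (by ext; simp) (by intro a b; ext; simp)
  comm := by intro a b m; ext i; simp [X.comm]

theorem pow_left_apply (X : Bimod K A B M) (n : ℕ) (a : A) (m : Fin n → M) (i : Fin n) :
    (X.pow n).left a m i = X.left a (m i) := rfl

theorem pow_right_apply (X : Bimod K A B M) (n : ℕ) (b : Bᵐᵒᵖ) (m : Fin n → M) (i : Fin n) :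
    (X.pow n).right b m i = X.right b (m i) := rfl

/-- Homomorphisms of bimodules. -/
def IsHom (X : Bimod K A B M) (Y : Bimod K A B N) (f : M →ₗ[K] N) : Prop :=
  (∀ a m, f (X.left a m) = Y.left a (f m)) ∧ (∀ b m, f (X.right b m) = Y.right b (f m))

/-- `X` is centrally projective with respect to `Y`: it is isomorphic, as a bimodule, to a direct
summand of a finite direct sum of copies of `Y` (there are bimodule maps `X → Yⁿ → X` whose
composite is the identity). -/
def CentrallyProjective (X : Bimod K A B M) (Y : Bimod K A B N) : Prop :=
  ∃ (n : ℕ) (i : M →ₗ[K] (Fin n → N)) (p : (Fin n → N) →ₗ[K] M),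
    IsHom X (Y.pow n) i ∧ IsHom (Y.pow n) X p ∧ ∀ m, p (i m) = m

/-- The relations `m b ⊗ n = m ⊗ b n`. -/
def tensRel (X : Bimod K A B M) (Y : Bimod K B C N) : Submodule K (M ⊗[K] N) :=
  Submodule.span K {z | ∃ (m : M) (b : B) (n : N),
    z = (X.right (op b) m) ⊗ₜ[K] n - m ⊗ₜ[K] (Y.left b n)}

/-- The tensor product `M ⊗_B N` of an `A`-`B`-bimodule with a `B`-`C`-bimodule, where `B` need not
be commutative. -/
abbrev Tens (X : Bimod K A B M) (Y : Bimod K B C N) : Type _ := (M ⊗[K] N) ⧸ tensRel X Y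

/-- The simple tensor `m ⊗_B n`. -/
def tmul (X : Bimod K A B M) (Y : Bimod K B C N) (m : M) (n : N) : Tens X Y :=
  (tensRel X Y).mkQ (m ⊗ₜ[K] n)

/-- The `K`-linear map out of `M ⊗_B N` given by a `B`-balanced `K`-bilinear map. -/
def tensLift {P : Type*} [AddCommGroup P] [Module K P] (X : Bimod K A B M) (Y : Bimod K B C N)
    (f : M →ₗ[K] N →ₗ[K] P) (hf : ∀ m b n, f (X.right (op b) m) n = f m (Y.left b n)) :
    Tens X Y →ₗ[K] P :=
  (tensRel X Y).liftQ (TensorProduct.lift f) (by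
    refine Submodule.span_le.2 ?_
    rintro _ ⟨m, b, n, rfl⟩
    simp [hf])

theorem tensLift_tmul {P : Type*} [AddCommGroup P] [Module K P] (X : Bimod K A B M)
    (Y : Bimod K B C N) (f : M →ₗ[K] N →ₗ[K] P)
    (hf : ∀ m b n, f (X.right (op b) m) n = f m (Y.left b n)) (m : M) (n : N) :
    tensLift X Y f hf (tmul X Y m n) = f m n := by
  exact (Submodule.liftQ_apply _ _ _).trans (TensorProduct.lift.tmul _ _)

theorem tmul_balanced (X : Bimod K A B M) (Y : Bimod K B C N) (m : M) (b : B) (n : N) :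
    tmul X Y (X.right (op b) m) n = tmul X Y m (Y.left b n) := by
  refine (Submodule.Quotient.eq _).2 (Submodule.subset_span ⟨m, b, n, rfl⟩)

theorem tens_hom_ext {P : Type*} [AddCommGroup P] [Module K P] (X : Bimod K A B M)
    (Y : Bimod K B C N) {f g : Tens X Y →ₗ[K] P}
    (h : ∀ m n, f (tmul X Y m n) = g (tmul X Y m n)) : f = g := by
  apply Submodule.linearMap_qext
  ext m n
  exact h m n

/-- The bilinear map `(m, n) ↦ m ⊗_B n`. -/
def tmulBilin (X : Bimod K A B M) (Y : Bimod K B C N) : M →ₗ[K] N →ₗ[K] Tens X Y :=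
  (TensorProduct.mk K M N).compr₂ (tensRel X Y).mkQ

theorem tmulBilin_apply (X : Bimod K A B M) (Y : Bimod K B C N) (m : M) (n : N) :
    tmulBilin X Y m n = tmul X Y m n := rfl

/-- The action of `a` on `M ⊗_B N` by `m ⊗ n ↦ a m ⊗ n`. -/
def tensLeft (X : Bimod K A B M) (Y : Bimod K B C N) (a : A) : Module.End K (Tens X Y) :=
  tensLift X Y ((tmulBilin X Y) ∘ₗ X.left a) (by
    intro m b n
    simp only [LinearMap.comp_apply, tmulBilin_apply, X.comm]
    exact tmul_balanced X Y _ b n)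

/-- The action of `c` on `M ⊗_B N` by `m ⊗ n ↦ m ⊗ n c`. -/
def tensRight (X : Bimod K A B M) (Y : Bimod K B C N) (c : Cᵐᵒᵖ) : Module.End K (Tens X Y) :=
  tensLift X Y ((tmulBilin X Y).compl₂ (Y.right c)) (by
    intro m b n
    simp only [LinearMap.compl₂_apply, tmulBilin_apply, ← Y.comm]
    exact tmul_balanced X Y m b _)

theorem tensLeft_tmul (X : Bimod K A B M) (Y : Bimod K B C N) (a : A) (m : M) (n : N) :
    tensLeft X Y a (tmul X Y m n) = tmul X Y (X.left a m) n :=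
  tensLift_tmul _ _ _ _ _ _

theorem tensRight_tmul (X : Bimod K A B M) (Y : Bimod K B C N) (c : Cᵐᵒᵖ) (m : M) (n : N) :
    tensRight X Y c (tmul X Y m n) = tmul X Y m (Y.right c n) :=
  tensLift_tmul _ _ _ _ _ _

/-- The `A`-`C`-bimodule `M ⊗_B N`. -/
def tens (X : Bimod K A B M) (Y : Bimod K B C N) : Bimod K A C (Tens X Y) where
  left := AlgHom.ofLinearMap
    { toFun := tensLeft X Y
      map_add' := by
        intro a b; apply tens_hom_ext; intro m n
        simp only [LinearMap.add_apply, tensLeft_tmul]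
        simp [← tmulBilin_apply]
      map_smul' := by
        intro a b; apply tens_hom_ext; intro m n
        simp only [LinearMap.smul_apply, RingHom.id_apply, tensLeft_tmul]
        simp [← tmulBilin_apply] }
    (by apply tens_hom_ext; intro m n; simp [tensLeft_tmul])
    (by intro a b; apply tens_hom_ext; intro m n; simp [tensLeft_tmul])
  right := AlgHom.ofLinearMap
    { toFun := tensRight X Y
      map_add' := by
        intro a b; apply tens_hom_ext; intro m n
        simp only [LinearMap.add_apply, tensRight_tmul]
        simp [← tmulBilin_apply]
      map_smul' := by
        intro a b; apply tens_hom_ext; intro m n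
        simp only [LinearMap.smul_apply, RingHom.id_apply, tensRight_tmul]
        simp [← tmulBilin_apply] }
    (by apply tens_hom_ext; intro m n; simp [tensRight_tmul])
    (by intro a b; apply tens_hom_ext; intro m n; simp [tensRight_tmul])
  comm := by
    intro a c z
    have : (tensLeft X Y a) ∘ₗ (tensRight X Y c) = (tensRight X Y c) ∘ₗ (tensLeft X Y a) := by
      apply tens_hom_ext; intro m n; simp [tensLeft_tmul, tensRight_tmul]
    exact LinearMap.congr_fun this z

end Basic

end Bimod

/-- An algebra extension `A ∥ B` is a unit-preserving `K`-algebra homomorphism `B → A`, which need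
not be injective. -/
abbrev AlgExt (K B A : Type*) [CommRing K] [Ring B] [Ring A] [Algebra K B] [Algebra K A] : Type _ :=
  B →ₐ[K] A

section Extension

variable {K A B : Type*} [CommRing K] [Ring A] [Ring B] [Algebra K A] [Algebra K B]

/-- The `A`-`B`-bimodule `A` of an algebra extension `φ : B → A`. -/
def natAB (φ : AlgExt K B A) : Bimod K A B A := (Bimod.regular K A).restrict (AlgHom.id K A) φ

/-- The `B`-`A`-bimodule `A` of an algebra extension `φ : B → A`. -/
def natBA (φ : AlgExt K B A) : Bimod K B A A := (Bimod.regular K A).restrict φ (AlgHom.id K A)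

/-- The underlying `K`-module of the tensor-square `A ⊗_B A`. -/
abbrev TensSq (φ : AlgExt K B A) : Type _ := Bimod.Tens (natAB φ) (natBA φ)

/-- The tensor-square `A ⊗_B A` as an `A`-`A`-bimodule. -/
def tensSq (φ : AlgExt K B A) : Bimod K A A (TensSq φ) := Bimod.tens (natAB φ) (natBA φ)

/-- The simple tensor `a ⊗_B a'`. -/
def tm (φ : AlgExt K B A) (a a' : A) : TensSq φ := Bimod.tmul (natAB φ) (natBA φ) a a'

/-- `A ∥ B` is left D2: `A ⊗_B A` is centrally projective with respect to `A` as a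
`B`-`A`-bimodule. -/
def IsLeftD2 (φ : AlgExt K B A) : Prop :=
  Bimod.CentrallyProjective ((tensSq φ).restrict φ (AlgHom.id K A)) (natBA φ)

/-- `A ∥ B` is right D2: `A ⊗_B A` is centrally projective with respect to `A` as an
`A`-`B`-bimodule. -/
def IsRightD2 (φ : AlgExt K B A) : Prop :=
  Bimod.CentrallyProjective ((tensSq φ).restrict (AlgHom.id K A) φ) (natAB φ)

/-- The left endomorphism algebra `ℰ = End(_B A)`, multiplied by composition. -/
def leftEnd (φ : AlgExt K B A) : Subalgebra K (Module.End K A) where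
  carrier := {f | ∀ b x, f (φ b * x) = φ b * f x}
  mul_mem' := by
    intro f g hf hg b x
    simp only [Module.End.mul_apply, hg b x, hf b (g x)]
  add_mem' := by
    intro f g hf hg b x
    simp only [LinearMap.add_apply, hf b x, hg b x, mul_add]
  algebraMap_mem' := by
    intro k b x
    simp

/-- The bimodule endomorphism algebra `S = End(_B A_B)`, multiplied by composition. -/
def bimodEnd (φ : AlgExt K B A) : Subalgebra K (Module.End K A) where
  carrier := {f | (∀ b x, f (φ b * x) = φ b * f x) ∧ ∀ b x, f (x * φ b) = f x * φ b}
  mul_mem' := by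
    rintro f g ⟨hf, hf'⟩ ⟨hg, hg'⟩
    refine ⟨fun b x => ?_, fun b x => ?_⟩
    · simp only [Module.End.mul_apply, hg b x, hf b (g x)]
    · simp only [Module.End.mul_apply, hg' b x, hf' b (g x)]
  add_mem' := by
    rintro f g ⟨hf, hf'⟩ ⟨hg, hg'⟩
    refine ⟨fun b x => ?_, fun b x => ?_⟩
    · simp only [LinearMap.add_apply, hf b x, hg b x, mul_add]
    · simp only [LinearMap.add_apply, hf' b x, hg' b x, add_mul]
  algebraMap_mem' := by
    intro k
    refine ⟨fun b x => ?_, fun b x => ?_⟩ <;> simp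

theorem bimodEnd_le_leftEnd (φ : AlgExt K B A) : bimodEnd φ ≤ leftEnd φ := fun _ hf => hf.1

/-- `T = (A ⊗_B A)^B`, the `B`-central elements of the tensor-square. -/
def centralTensor (φ : AlgExt K B A) : Submodule K (TensSq φ) where
  carrier := {t | ∀ b, (tensSq φ).left (φ b) t = (tensSq φ).right (op (φ b)) t}
  zero_mem' := by intro b; simp
  add_mem' := by intro s t hs ht b; simp only [map_add, hs b, ht b]
  smul_mem' := by intro k t ht b; simp only [map_smul, ht b]

/-- Left D2 quasibase: `β_i ∈ S`, `t_i ∈ T` with `a ⊗ a' = ∑ t_i β_i(a) a'`. -/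
def IsLeftD2Quasibase (φ : AlgExt K B A) {n : ℕ} (β : Fin n → bimodEnd φ)
    (t : Fin n → centralTensor φ) : Prop :=
  ∀ a a' : A, tm φ a a' = ∑ i, (tensSq φ).right (op ((β i : Module.End K A) a * a')) (t i)

/-- Right D2 quasibase: `γ_j ∈ S`, `u_j ∈ T` with `a ⊗ a' = ∑ a γ_j(a') u_j`. -/
def IsRightD2Quasibase (φ : AlgExt K B A) {n : ℕ} (γ : Fin n → bimodEnd φ)
    (u : Fin n → centralTensor φ) : Prop :=
  ∀ a a' : A, tm φ a a' = ∑ j, (tensSq φ).left (a * (γ j : Module.End K A) a') (u j)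

/-- `A ∥ B` is left balanced: the module `_B A` is balanced, that is, every endomorphism of `A` as a
module over `End(_B A)` is the multiplication by an element of `B`. -/
def IsLeftBalanced (φ : AlgExt K B A) : Prop :=
  ∀ g : Module.End K A, (∀ f ∈ leftEnd φ, ∀ x, g (f x) = f (g x)) → ∃ b : B, ∀ x, g x = φ b * x

/-- The left endomorphism extension `ρ : A^op → ℰ`, `ρ(a)(x) = x a`. -/
def rho (φ : AlgExt K B A) : AlgExt K Aᵐᵒᵖ (leftEnd φ) :=
  (Bimod.regular K A).right.codRestrict (leftEnd φ) (by
    intro a b x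
    simp [Bimod.regular, mul_assoc])

theorem rho_apply (φ : AlgExt K B A) (a x : A) : (rho φ (op a) : Module.End K A) x = x * a := rfl

/-- For `α ∈ S` and `v = v¹ ⊗ v² ∈ A ⊗_B A`, the endomorphism `α(- v¹) v²` of `A`. -/
def twistAux (φ : AlgExt K B A) (α : bimodEnd φ) : TensSq φ →ₗ[K] Module.End K A :=
  Bimod.tensLift (natAB φ) (natBA φ)
    (LinearMap.mk₂ K
      (fun p q => (LinearMap.mulRight K q) ∘ₗ (α : Module.End K A) ∘ₗ (LinearMap.mulRight K p))
      (by intro p p' q; ext x; simp [mul_add, add_mul])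
      (by intro k p q; ext x; simp)
      (by intro p q q'; ext x; simp [mul_add])
      (by intro k p q; ext x; simp))
    (by
      intro p b q
      ext x
      have h : (α : Module.End K A) (x * (p * φ b)) = (α : Module.End K A) (x * p) * φ b := by
        rw [← mul_assoc]; exact α.2.2 b (x * p)
      have h2 : (α : Module.End K A) (x * (p * φ b)) * q
          = (α : Module.End K A) (x * p) * (φ b * q) := by rw [h, mul_assoc]
      exact h2)

theorem twistAux_tm (φ : AlgExt K B A) (α : bimodEnd φ) (p q x : A) :
    twistAux φ α (tm φ p q) x = (α : Module.End K A) (x * p) * q := by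
  simp [twistAux, tm, Bimod.tensLift_tmul]

theorem tensSq_induction (φ : AlgExt K B A) {P : TensSq φ → Prop} (h0 : P 0)
    (h : ∀ p q, P (tm φ p q)) (ha : ∀ v w, P v → P w → P (v + w)) (v : TensSq φ) : P v := by
  obtain ⟨z, rfl⟩ := Submodule.mkQ_surjective _ v
  induction z using TensorProduct.induction_on with
  | zero => simpa using h0
  | tmul p q => exact h p q
  | add y z hy hz => rw [map_add]; exact ha _ _ hy hz

/-- The element `α(- v¹) v²` of `ℰ`. -/
def twist (φ : AlgExt K B A) (α : bimodEnd φ) (v : TensSq φ) : leftEnd φ :=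
  ⟨twistAux φ α v, by
    intro b x
    induction v using tensSq_induction with
    | h0 => simp
    | h p q =>
      have h := α.2.1 b (x * p)
      rw [← mul_assoc] at h
      rw [twistAux_tm, twistAux_tm, h, mul_assoc]
    | ha v w hv hw => simp only [map_add, LinearMap.add_apply, hv, hw, mul_add]⟩

/-- For `f ∈ ℰ` and `v = v¹ ⊗ v² ∈ A ⊗_B A`, the endomorphism `v¹ f(v² -)` of `A`. -/
def actAux (φ : AlgExt K B A) (f : leftEnd φ) : TensSq φ →ₗ[K] Module.End K A :=
  Bimod.tensLift (natAB φ) (natBA φ)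
    (LinearMap.mk₂ K
      (fun p q => (LinearMap.mulLeft K p) ∘ₗ (f : Module.End K A) ∘ₗ (LinearMap.mulLeft K q))
      (by intro p p' q; ext x; simp [add_mul])
      (by intro k p q; ext x; simp)
      (by intro p q q'; ext x; simp [mul_add, add_mul])
      (by intro k p q; ext x; simp))
    (by
      intro p b q
      ext x
      have h : p * φ b * (f : Module.End K A) (q * x) = p * (f : Module.End K A) (φ b * q * x) := by
        rw [mul_assoc (φ b), f.2 b (q * x), mul_assoc]
      exact h)

theorem actAux_tm (φ : AlgExt K B A) (f : leftEnd φ) (p q x : A) :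
    actAux φ f (tm φ p q) x = p * (f : Module.End K A) (q * x) := by
  simp [actAux, tm, Bimod.tensLift_tmul]

theorem tensSq_left_tm (φ : AlgExt K B A) (a p q : A) :
    (tensSq φ).left a (tm φ p q) = tm φ (a * p) q :=
  Bimod.tensLeft_tmul _ _ _ _ _

theorem tensSq_right_tm (φ : AlgExt K B A) (a p q : A) :
    (tensSq φ).right (op a) (tm φ p q) = tm φ p (q * a) :=
  Bimod.tensRight_tmul _ _ _ _ _

theorem actAux_left (φ : AlgExt K B A) (f : leftEnd φ) (a : A) (v : TensSq φ) (x : A) :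
    actAux φ f ((tensSq φ).left a v) x = a * actAux φ f v x := by
  induction v using tensSq_induction with
  | h0 => simp
  | h p q => rw [tensSq_left_tm, actAux_tm, actAux_tm, mul_assoc]
  | ha v w hv hw => simp only [map_add, LinearMap.add_apply, hv, hw, mul_add]

theorem actAux_right (φ : AlgExt K B A) (f : leftEnd φ) (a : A) (v : TensSq φ) (x : A) :
    actAux φ f ((tensSq φ).right (op a) v) x = actAux φ f v (a * x) := by
  induction v using tensSq_induction with
  | h0 => simp
  | h p q => rw [tensSq_right_tm, actAux_tm, actAux_tm, mul_assoc]
  | ha v w hv hw => simp only [map_add, LinearMap.add_apply, hv, hw]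

/-- The right action of `T` on `ℰ`: `f ◁ u = u¹ f(u² -)`. -/
def act (φ : AlgExt K B A) (f : leftEnd φ) (u : centralTensor φ) : leftEnd φ :=
  ⟨actAux φ f u, fun b x => by rw [← actAux_right, ← u.2 b, actAux_left]⟩

theorem actAux_eq_add (φ : AlgExt K B A) (f g h : leftEnd φ) (v : TensSq φ)
    (H : ∀ p q x, actAux φ f (tm φ p q) x = actAux φ g (tm φ p q) x + actAux φ h (tm φ p q) x) :
    actAux φ f v = actAux φ g v + actAux φ h v := by
  ext x
  induction v using tensSq_induction with
  | h0 => simp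
  | h p q => exact H p q x
  | ha v w hv hw =>
    simp only [map_add, LinearMap.add_apply] at hv hw ⊢
    rw [hv, hw]; abel

/-- The `ρ(A)`-`ρ(A)`-bimodule endomorphism `f ↦ f ◁ u` of `ℰ`, for `u ∈ T`. -/
def actEnd (φ : AlgExt K B A) (u : centralTensor φ) : bimodEnd (rho φ) :=
  ⟨{ toFun := fun f => act φ f u
     map_add' := by
       intro f g
       apply Subtype.ext
       refine actAux_eq_add φ _ _ _ u.1 fun p q x => ?_
       simp [actAux_tm, mul_add]
     map_smul' := by
       intro k f
       apply Subtype.ext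
       ext x
       change actAux φ (k • f) u.1 x = k • actAux φ f u.1 x
       induction u.1 using tensSq_induction with
       | h0 => simp
       | h p q => simp [actAux_tm]
       | ha v w hv hw => simp only [map_add, LinearMap.add_apply, hv, hw, smul_add] }, by
    constructor
    · intro a f
      apply Subtype.ext
      ext x
      change actAux φ (rho φ a * f) u.1 x = actAux φ f u.1 x * a.unop
      induction u.1 using tensSq_induction with
      | h0 => simp
      | h p q =>
        rw [actAux_tm, actAux_tm, mul_assoc]
        rfl
      | ha v w hv hw => simp only [map_add, LinearMap.add_apply, hv, hw, add_mul]
    · intro a f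
      apply Subtype.ext
      ext x
      change actAux φ (f * rho φ a) u.1 x = actAux φ f u.1 (x * a.unop)
      induction u.1 using tensSq_induction with
      | h0 => simp
      | h p q =>
        rw [actAux_tm, actAux_tm, ← mul_assoc]
        rfl
      | ha v w hv hw => simp only [map_add, LinearMap.add_apply, hv, hw]⟩

/-- The element `∑_k γ_j(- u_k¹) u_k² ⊗ γ_k` of `ℰ ⊗_{ρ(A)} ℰ`. -/
def endoTensor (φ : AlgExt K B A) {n : ℕ} (γ : Fin n → bimodEnd φ) (u : Fin n → centralTensor φ)
    (j : Fin n) : TensSq (rho φ) :=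
  ∑ k, tm (rho φ) (twist φ (γ j) (u k)) ⟨γ k, bimodEnd_le_leftEnd φ (γ k).2⟩

end Extension

end DepthTwo

end

/-!
Everything rests on the `K`-linear map `endoEval φ x y : f ⊗ g ↦ f (x * g y)` from
`ℰ ⊗_{ρ(A)} ℰ` to `A`, that is, on the canonical map `ℰ ⊗_{ρ(A)} ℰ → Hom(_B (A ⊗_B A), _B A)`
evaluated at `x ⊗_B y`.

A right D2 quasibase `(γ_j, u_j)` makes the canonical map split injective: a homomorphism `F` in its
image comes from `∑_k F(- u_k) ⊗ γ_k`, because `∑_k γ_k(y) u_k = 1 ⊗ y` (`sum_endoRetract`). Hence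
identities in `ℰ ⊗_{ρ(A)} ℰ` may be tested by applying `endoEval φ x y` for all `x, y`
(`endoEval_separates`). The tensor `T_j` goes to `γ_j(x) y` (`endoEval_endoTensor`), so it visibly
commutes with `ρ(A)`, and `∑_j T_j 𝓑_j(f) g` goes to `∑_j γ_j(x) u_j¹ f(u_j² g(y)) = f(x g(y))`,
the image of `f ⊗ g`.

The rest is the usual dictionary between quasibases and central projectivity
(`exists_isRightD2Quasibase`, `isLeftD2_of_quasibase`). The extension `ℰ ∥ A^op` is balanced for any
`A ∥ B` (`isLeftBalanced_rho`): an endomorphism commuting with right multiplications on `ℰ` is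
left multiplication by some `h`, and commuting with `f ↦ (y ↦ y f(1))` forces `h(y) = y h(1)`.
-/

open MulOpposite

noncomputable section

namespace DepthTwo

section

variable {K A B : Type*} [CommRing K] [Ring A] [Ring B] [Algebra K A] [Algebra K B]

/-! ### The bimodule structure of the tensor-square -/

theorem tm_balanced (φ : AlgExt K B A) (a a' : A) (b : B) :
    tm φ (a * φ b) a' = tm φ a (φ b * a') :=
  Bimod.tmul_balanced (natAB φ) (natBA φ) a b a'

theorem tm_add_left (φ : AlgExt K B A) (a x y : A) :
    tm φ (x + y) a = tm φ x a + tm φ y a :=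
  LinearMap.map_add₂ (Bimod.tmulBilin (natAB φ) (natBA φ)) x y a

theorem tm_zero_left (φ : AlgExt K B A) (a : A) : tm φ 0 a = 0 :=
  LinearMap.map_zero₂ (Bimod.tmulBilin (natAB φ) (natBA φ)) a

theorem tm_sum_right (φ : AlgExt K B A) {ι : Type*} (s : Finset ι) (a : A) (x : ι → A) :
    tm φ a (∑ i ∈ s, x i) = ∑ i ∈ s, tm φ a (x i) :=
  map_sum (Bimod.tmulBilin (natAB φ) (natBA φ) a) x s

theorem tensSq_left_mul (φ : AlgExt K B A) (a b : A) (v : TensSq φ) :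
    (tensSq φ).left (a * b) v = (tensSq φ).left a ((tensSq φ).left b v) := by
  rw [map_mul, Module.End.mul_apply]

theorem tensSq_right_mul (φ : AlgExt K B A) (a b : A) (v : TensSq φ) :
    (tensSq φ).right (op (a * b)) v = (tensSq φ).right (op b) ((tensSq φ).right (op a) v) := by
  rw [op_mul, map_mul, Module.End.mul_apply]

/-! ### Quasibases and central projectivity -/

/-- The `B`-`A`-bimodule homomorphism `A ⊗_B A → A`, `a ⊗ a' ↦ β(a) a'`. -/
def quasiCoord (φ : AlgExt K B A) (β : bimodEnd φ) : TensSq φ →ₗ[K] A :=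
  Bimod.tensLift (natAB φ) (natBA φ) ((LinearMap.mul K A) ∘ₗ (β : Module.End K A)) (by
    intro m b n
    change (β : Module.End K A) (m * φ b) * n = (β : Module.End K A) m * (φ b * n)
    rw [β.2.2, mul_assoc])

theorem quasiCoord_tm (φ : AlgExt K B A) (β : bimodEnd φ) (a a' : A) :
    quasiCoord φ β (tm φ a a') = (β : Module.End K A) a * a' :=
  Bimod.tensLift_tmul _ _ _ _ _ _

theorem quasiCoord_left (φ : AlgExt K B A) (β : bimodEnd φ) (b : B) (v : TensSq φ) :
    quasiCoord φ β ((tensSq φ).left (φ b) v) = φ b * quasiCoord φ β v := by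
  induction v using tensSq_induction with
  | h0 => simp
  | h p q => rw [tensSq_left_tm, quasiCoord_tm, quasiCoord_tm, β.2.1, mul_assoc]
  | ha v w hv hw => simp only [map_add, hv, hw, mul_add]

theorem quasiCoord_right (φ : AlgExt K B A) (β : bimodEnd φ) (a : A) (v : TensSq φ) :
    quasiCoord φ β ((tensSq φ).right (op a) v) = quasiCoord φ β v * a := by
  induction v using tensSq_induction with
  | h0 => simp
  | h p q => rw [tensSq_right_tm, quasiCoord_tm, quasiCoord_tm, mul_assoc]
  | ha v w hv hw => simp only [map_add, hv, hw, add_mul]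

/-- The homomorphism `Aⁿ → A ⊗_B A`, `(a_i) ↦ ∑ t_i a_i`. -/
def quasiSum (φ : AlgExt K B A) {n : ℕ} (t : Fin n → centralTensor φ) :
    (Fin n → A) →ₗ[K] TensSq φ :=
  ∑ i, (((tensSq φ).right.toLinearMap.flip (t i).1) ∘ₗ (opLinearEquiv K).toLinearMap) ∘ₗ
    LinearMap.proj i

theorem quasiSum_apply (φ : AlgExt K B A) {n : ℕ} (t : Fin n → centralTensor φ) (m : Fin n → A) :
    quasiSum φ t m = ∑ i, (tensSq φ).right (op (m i)) (t i).1 := by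
  simp [quasiSum]

theorem isLeftD2_of_quasibase (φ : AlgExt K B A) {n : ℕ} (β : Fin n → bimodEnd φ)
    (t : Fin n → centralTensor φ) (h : IsLeftD2Quasibase φ β t) : IsLeftD2 φ := by
  refine ⟨n, LinearMap.pi fun i => quasiCoord φ (β i), quasiSum φ t, ⟨?_, ?_⟩, ⟨?_, ?_⟩, ?_⟩
  · intro b v
    ext i
    exact quasiCoord_left φ (β i) b v
  · intro a v
    ext i
    exact quasiCoord_right φ (β i) a.unop v
  · intro b m
    change _ = (tensSq φ).left (φ b) (quasiSum φ t m)
    rw [quasiSum_apply, quasiSum_apply, map_sum]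
    refine Finset.sum_congr rfl fun i _ => ?_
    change (tensSq φ).right (op (φ b * m i)) (t i).1 = _
    rw [tensSq_right_mul, ← (t i).2 b, (tensSq φ).comm]
  · intro a m
    change _ = (tensSq φ).right (op a.unop) (quasiSum φ t m)
    rw [quasiSum_apply, quasiSum_apply, map_sum]
    refine Finset.sum_congr rfl fun i _ => ?_
    change (tensSq φ).right (op (m i * a.unop)) (t i).1 = _
    rw [tensSq_right_mul]
  · intro v
    rw [quasiSum_apply]
    induction v using tensSq_induction with
    | h0 => simp
    | h p q =>
      simp only [LinearMap.pi_apply, quasiCoord_tm]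
      exact (h p q).symm
    | ha v w hv hw =>
      simp only [LinearMap.pi_apply] at hv hw
      simp only [LinearMap.pi_apply, map_add, op_add, LinearMap.add_apply,
        Finset.sum_add_distrib, hv, hw]

/-- From bimodule maps `i : A ⊗_B A → Aⁿ` and `p : Aⁿ → A ⊗_B A` with `p ∘ i = id` one gets the
quasibase `γ_j(a) = i(1 ⊗ a)_j`, `u_j = p(e_j)`. -/
theorem exists_isRightD2Quasibase (φ : AlgExt K B A) (hφ : IsRightD2 φ) :
    ∃ (n : ℕ) (γ : Fin n → bimodEnd φ) (u : Fin n → centralTensor φ),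
      IsRightD2Quasibase φ γ u := by
  obtain ⟨n, i, p, ⟨hi, hi'⟩, ⟨hp, hp'⟩, hpi⟩ := hφ
  have hiL (a : A) (v : TensSq φ) (j : Fin n) : i ((tensSq φ).left a v) j = a * i v j :=
    congrFun (hi a v) j
  have hiR (b : B) (v : TensSq φ) (j : Fin n) :
      i ((tensSq φ).right (op (φ b)) v) j = i v j * φ b :=
    congrFun (hi' (op b) v) j
  have hpL (a : A) (m : Fin n → A) : p (fun k => a * m k) = (tensSq φ).left a (p m) := hp a m
  have hpR (b : B) (m : Fin n → A) :
      p (fun k => m k * φ b) = (tensSq φ).right (op (φ b)) (p m) := hp' (op b) m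
  refine ⟨n, fun j => ⟨LinearMap.proj j ∘ₗ i ∘ₗ Bimod.tmulBilin (natAB φ) (natBA φ) 1, ?_, ?_⟩,
    fun j => ⟨p (Pi.single j 1), ?_⟩, ?_⟩
  · intro b x
    change i (tm φ 1 (φ b * x)) j = φ b * i (tm φ 1 x) j
    rw [← tm_balanced, one_mul, ← hiL, tensSq_left_tm, mul_one]
  · intro b x
    change i (tm φ 1 (x * φ b)) j = i (tm φ 1 x) j * φ b
    rw [← hiR, tensSq_right_tm]
  · intro b
    rw [← hpL, ← hpR]
    congr 1
    ext k
    by_cases hk : k = j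
    · subst hk; simp
    · simp [hk]
  · intro a a'
    change tm φ a a' = ∑ j, (tensSq φ).left (a * i (tm φ 1 a') j) (p (Pi.single j 1))
    have h : tm φ a a' = (tensSq φ).left a (tm φ 1 a') := by rw [tensSq_left_tm, mul_one]
    rw [h]
    conv_lhs => rw [← hpi (tm φ 1 a'), ← Finset.univ_sum_single (i (tm φ 1 a'))]
    rw [map_sum, map_sum]
    refine Finset.sum_congr rfl fun j _ => ?_
    rw [tensSq_left_mul, ← hpL (i (tm φ 1 a') j)]
    congr 2
    ext k
    by_cases hk : k = j
    · subst hk; simp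
    · simp [hk]

/-! ### Balancedness of the endomorphism extension -/

theorem rho_injective (φ : AlgExt K B A) : Function.Injective (rho φ) := by
  intro a b h
  have h1 := congrArg (fun f : leftEnd φ => (f : Module.End K A) 1) h
  change 1 * a.unop = 1 * b.unop at h1
  simpa using h1

/-- The endomorphism `f ↦ (y ↦ y f(1))` of `ℰ`, which is linear over `ρ(A)`. -/
def evalOneEnd (φ : AlgExt K B A) : Module.End K (leftEnd φ) where
  toFun f := rho φ (op ((f : Module.End K A) 1))
  map_add' f g := by
    rw [Subalgebra.coe_add, LinearMap.add_apply, op_add, map_add]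
  map_smul' k f := by
    rw [Subalgebra.coe_smul, LinearMap.smul_apply, op_smul, map_smul, RingHom.id_apply]

theorem isLeftBalanced_rho (φ : AlgExt K B A) : IsLeftBalanced (rho φ) := by
  intro g hg
  -- Right multiplication by `f` is `ρ(A)`-linear, hence commutes with `g`.
  have hmul (f : leftEnd φ) : g f = g 1 * f := by
    have h := hg (LinearMap.mulRight K f) (fun b x => mul_assoc _ _ _) 1
    simpa using h
  have hev : evalOneEnd φ ∈ leftEnd (rho φ) := fun a f => map_mul (rho φ) a _
  refine ⟨op ((g 1 : Module.End K A) 1), fun f => ?_⟩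
  have h := hg (evalOneEnd φ) hev 1
  have h1 : evalOneEnd φ 1 = 1 := map_one (rho φ)
  rw [h1] at h
  rw [hmul f]
  congr 1

/-! ### The canonical map out of the tensor-square of the endomorphism algebra -/

/-- The evaluation `f ⊗ g ↦ f (x * g y)` on `ℰ ⊗_{ρ(A)} ℰ`. -/
def endoEval (φ : AlgExt K B A) (x y : A) : TensSq (rho φ) →ₗ[K] A :=
  Bimod.tensLift (natAB (rho φ)) (natBA (rho φ))
    (LinearMap.mk₂ K
      (fun f g => (f : Module.End K A) (x * (g : Module.End K A) y))
      (by intro f f' g; simp)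
      (by intro k f g; simp)
      (by intro f g g'; simp [mul_add])
      (by intro k f g; simp))
    (by
      intro f a g
      change (f : Module.End K A) (x * (g : Module.End K A) y * a.unop) =
        (f : Module.End K A) (x * ((g : Module.End K A) y * a.unop))
      rw [mul_assoc])

theorem endoEval_tm (φ : AlgExt K B A) (x y : A) (f g : leftEnd φ) :
    endoEval φ x y (tm (rho φ) f g) = (f : Module.End K A) (x * (g : Module.End K A) y) :=
  Bimod.tensLift_tmul _ _ _ _ _ _

theorem endoEval_left (φ : AlgExt K B A) (x y a : A) (z : TensSq (rho φ)) :
    endoEval φ x y ((tensSq (rho φ)).left (rho φ (op a)) z) = endoEval φ x y z * a := by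
  induction z using tensSq_induction with
  | h0 => simp
  | h f g => rw [tensSq_left_tm, endoEval_tm, endoEval_tm]; rfl
  | ha v w hv hw => simp only [map_add, hv, hw, add_mul]

theorem endoEval_right (φ : AlgExt K B A) (x y : A) (e : leftEnd φ) (z : TensSq (rho φ)) :
    endoEval φ x y ((tensSq (rho φ)).right (op e) z) =
      endoEval φ x ((e : Module.End K A) y) z := by
  induction z using tensSq_induction with
  | h0 => simp
  | h f g => rw [tensSq_right_tm, endoEval_tm, endoEval_tm]; rfl
  | ha v w hv hw => simp only [map_add, hv, hw]

/-- For `v = v¹ ⊗ v²`, the map `ℰ → A`, `g ↦ v¹ g(v²)`. -/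
def tensorEval (φ : AlgExt K B A) (v : TensSq φ) : leftEnd φ →ₗ[K] A where
  toFun g := actAux φ g v 1
  map_add' f g := by
    rw [actAux_eq_add φ (f + g) f g v fun p q x => ?_, LinearMap.add_apply]
    simp [actAux_tm, mul_add]
  map_smul' k f := by
    induction v using tensSq_induction with
    | h0 => simp
    | h p q => simp [actAux_tm]
    | ha v w hv hw => simp only [map_add, LinearMap.add_apply, hv, hw, smul_add]

theorem tensorEval_tm (φ : AlgExt K B A) (p q : A) (g : leftEnd φ) :
    tensorEval φ (tm φ p q) g = p * (g : Module.End K A) q := by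
  change actAux φ g (tm φ p q) 1 = _
  rw [actAux_tm, mul_one]

theorem tensorEval_add (φ : AlgExt K B A) (v w : TensSq φ) (g : leftEnd φ) :
    tensorEval φ (v + w) g = tensorEval φ v g + tensorEval φ w g := by
  change actAux φ g (v + w) 1 = _
  rw [map_add]
  rfl

theorem tensorEval_zero (φ : AlgExt K B A) (g : leftEnd φ) : tensorEval φ 0 g = 0 := by
  change actAux φ g 0 1 = 0
  rw [map_zero]
  rfl

theorem tensorEval_left (φ : AlgExt K B A) (a : A) (v : TensSq φ) (g : leftEnd φ) :
    tensorEval φ ((tensSq φ).left a v) g = a * tensorEval φ v g :=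
  actAux_left φ g a v 1

theorem tensorEval_rho_mul (φ : AlgExt K B A) (v : TensSq φ) (a : A) (g : leftEnd φ) :
    tensorEval φ v (rho φ (op a) * g) = tensorEval φ v g * a := by
  induction v using tensSq_induction with
  | h0 => simp [tensorEval_zero]
  | h p q =>
    rw [tensorEval_tm, tensorEval_tm, mul_assoc]
    rfl
  | ha v w hv hw => rw [tensorEval_add, tensorEval_add, hv, hw, add_mul]

/-- For `v ∈ A ⊗_B A`, the map `ℰ ⊗_{ρ(A)} ℰ → ℰ`, `f ⊗ g ↦ f(- v¹ g(v²))`. Under the canonical map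
to `Hom(_B (A ⊗_B A), _B A)` it becomes `F ↦ F(- v)`. -/
def endoRetract (φ : AlgExt K B A) (v : TensSq φ) : TensSq (rho φ) →ₗ[K] leftEnd φ :=
  Bimod.tensLift (natAB (rho φ)) (natBA (rho φ))
    (LinearMap.mk₂ K
      (fun f g => f * rho φ (op (tensorEval φ v g)))
      (by intro f f' g; rw [add_mul])
      (by intro k f g; rw [smul_mul_assoc])
      (by intro f g g'; rw [map_add, op_add, map_add, mul_add])
      (by intro k f g; rw [map_smul, op_smul, map_smul, mul_smul_comm]))
    (by
      intro f a g
      change f * rho φ a * rho φ (op (tensorEval φ v g)) =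
        f * rho φ (op (tensorEval φ v (rho φ (op a.unop) * g)))
      rw [tensorEval_rho_mul, op_mul, map_mul, mul_assoc]
      rfl)

theorem endoRetract_tm (φ : AlgExt K B A) (v : TensSq φ) (f g : leftEnd φ) :
    endoRetract φ v (tm (rho φ) f g) = f * rho φ (op (tensorEval φ v g)) :=
  Bimod.tensLift_tmul _ _ _ _ _ _

theorem endoRetract_tm_apply (φ : AlgExt K B A) (v : TensSq φ) (f g : leftEnd φ) (x : A) :
    (endoRetract φ v (tm (rho φ) f g) : Module.End K A) x =
      (f : Module.End K A) (x * tensorEval φ v g) := by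
  rw [endoRetract_tm]
  rfl

theorem endoRetract_simple (φ : AlgExt K B A) (p q x : A) (z : TensSq (rho φ)) :
    (endoRetract φ (tm φ p q) z : Module.End K A) x = endoEval φ (x * p) q z := by
  induction z using tensSq_induction with
  | h0 => simp
  | h f g => rw [endoRetract_tm_apply, tensorEval_tm, endoEval_tm, mul_assoc]
  | ha v w hv hw => simp only [map_add, Subalgebra.coe_add, LinearMap.add_apply, hv, hw]

theorem endoRetract_add (φ : AlgExt K B A) (v w : TensSq φ) (z : TensSq (rho φ)) :
    endoRetract φ (v + w) z = endoRetract φ v z + endoRetract φ w z := by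
  induction z using tensSq_induction with
  | h0 => simp
  | h f g =>
    rw [endoRetract_tm, endoRetract_tm, endoRetract_tm, tensorEval_add, op_add, map_add, mul_add]
  | ha y z hy hz =>
    simp only [map_add, hy, hz]
    abel

theorem endoRetract_zero (φ : AlgExt K B A) (z : TensSq (rho φ)) : endoRetract φ 0 z = 0 := by
  have h := endoRetract_add φ 0 0 z
  rw [add_zero] at h
  exact left_eq_add.mp h

theorem endoRetract_eq_zero (φ : AlgExt K B A) (z : TensSq (rho φ))
    (hz : ∀ x y, endoEval φ x y z = 0) (v : TensSq φ) : endoRetract φ v z = 0 := by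
  induction v using tensSq_induction with
  | h0 => exact endoRetract_zero φ z
  | h p q =>
    apply Subtype.ext
    ext x
    rw [endoRetract_simple, hz]
    rfl
  | ha v w hv hw => rw [endoRetract_add, hv, hw, add_zero]

/-! ### The left quasibase of the endomorphism extension -/

/-- Coordinates of an endomorphism: `g(y) = ∑ γ_k(y) u_k¹ g(u_k²)`, from `1 ⊗ y = ∑ γ_k(y) u_k`. -/
theorem sum_rho_tensorEval_mul (φ : AlgExt K B A) {n : ℕ} (γ : Fin n → bimodEnd φ)
    (u : Fin n → centralTensor φ) (h : IsRightD2Quasibase φ γ u) (g : leftEnd φ) :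
    ∑ k, rho φ (op (tensorEval φ (u k) g)) *
      (⟨γ k, bimodEnd_le_leftEnd φ (γ k).2⟩ : leftEnd φ) = g := by
  apply Subtype.ext
  ext y
  have hsum : ∀ s : Finset (Fin n), ∑ k ∈ s, (γ k : Module.End K A) y * tensorEval φ (u k) g =
      tensorEval φ (∑ k ∈ s, (tensSq φ).left ((γ k : Module.End K A) y) (u k)) g := by
    intro s
    induction s using Finset.cons_induction with
    | empty => simp [tensorEval_zero]
    | cons k s hk ih =>
      rw [Finset.sum_cons, Finset.sum_cons, tensorEval_add, tensorEval_left, ih]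
  have h1 := h 1 y
  simp only [one_mul] at h1
  have h2 := hsum Finset.univ
  rw [← h1, tensorEval_tm, one_mul] at h2
  rw [AddSubmonoidClass.coe_finsetSum, LinearMap.sum_apply]
  exact h2

/-- The canonical map is split: `z` is recovered from the values `endoRetract φ (u k) z`, which only
depend on its image. For `z = f ⊗ g` the factor `ρ(u_k¹ g(u_k²))` moves across the tensor sign. -/
theorem sum_endoRetract (φ : AlgExt K B A) {n : ℕ} (γ : Fin n → bimodEnd φ)
    (u : Fin n → centralTensor φ) (h : IsRightD2Quasibase φ γ u) (z : TensSq (rho φ)) :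
    ∑ k, tm (rho φ) (endoRetract φ (u k) z) ⟨γ k, bimodEnd_le_leftEnd φ (γ k).2⟩ = z := by
  induction z using tensSq_induction with
  | h0 => simp [tm_zero_left]
  | h f g =>
    simp only [endoRetract_tm, tm_balanced]
    rw [← tm_sum_right, sum_rho_tensorEval_mul φ γ u h g]
  | ha v w hv hw => simp only [map_add, tm_add_left, Finset.sum_add_distrib, hv, hw]

theorem endoEval_separates (φ : AlgExt K B A) {n : ℕ} (γ : Fin n → bimodEnd φ)
    (u : Fin n → centralTensor φ) (h : IsRightD2Quasibase φ γ u) {z z' : TensSq (rho φ)}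
    (hz : ∀ x y, endoEval φ x y z = endoEval φ x y z') : z = z' := by
  rw [← sub_eq_zero, ← sum_endoRetract φ γ u h (z - z')]
  refine Finset.sum_eq_zero fun k _ => ?_
  rw [endoRetract_eq_zero φ (z - z') (fun x y => by rw [map_sub, hz, sub_self]), tm_zero_left]

theorem twistAux_left (φ : AlgExt K B A) (α : bimodEnd φ) (a x : A) (v : TensSq φ) :
    twistAux φ α ((tensSq φ).left a v) x = twistAux φ α v (x * a) := by
  induction v using tensSq_induction with
  | h0 => simp
  | h p q => rw [tensSq_left_tm, twistAux_tm, twistAux_tm, mul_assoc]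
  | ha v w hv hw => simp only [map_add, LinearMap.add_apply, hv, hw]

theorem endoEval_endoTensor (φ : AlgExt K B A) {n : ℕ} (γ : Fin n → bimodEnd φ)
    (u : Fin n → centralTensor φ) (h : IsRightD2Quasibase φ γ u) (j : Fin n) (x y : A) :
    endoEval φ x y (endoTensor φ γ u j) = (γ j : Module.End K A) x * y := by
  have hk (k : Fin n) : endoEval φ x y
      (tm (rho φ) (twist φ (γ j) (u k)) ⟨γ k, bimodEnd_le_leftEnd φ (γ k).2⟩) =
      twistAux φ (γ j) ((tensSq φ).left (x * (γ k : Module.End K A) y) (u k)) 1 := by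
    rw [endoEval_tm, twistAux_left, one_mul]
    rfl
  rw [endoTensor, map_sum, Finset.sum_congr rfl fun k _ => hk k, ← LinearMap.sum_apply,
    ← map_sum, ← h x y, twistAux_tm, one_mul]

theorem endoTensor_mem_centralTensor (φ : AlgExt K B A) {n : ℕ} (γ : Fin n → bimodEnd φ)
    (u : Fin n → centralTensor φ) (h : IsRightD2Quasibase φ γ u) (j : Fin n) :
    endoTensor φ γ u j ∈ centralTensor (rho φ) := by
  intro a
  refine endoEval_separates φ γ u h fun x y => ?_
  have h1 := endoEval_left φ x y a.unop (endoTensor φ γ u j)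
  rw [op_unop] at h1
  rw [h1, endoEval_right, endoEval_endoTensor φ γ u h, endoEval_endoTensor φ γ u h, mul_assoc]
  rfl

theorem isLeftD2Quasibase_rho (φ : AlgExt K B A) {n : ℕ} (γ : Fin n → bimodEnd φ)
    (u : Fin n → centralTensor φ) (h : IsRightD2Quasibase φ γ u) :
    IsLeftD2Quasibase (rho φ) (fun j => actEnd φ (u j))
      (fun j => ⟨endoTensor φ γ u j, endoTensor_mem_centralTensor φ γ u h j⟩) := by
  intro f g
  refine endoEval_separates φ γ u h fun x y => ?_
  have hj (j : Fin n) : endoEval φ x y ((tensSq (rho φ)).right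
      (op ((actEnd φ (u j) : Module.End K (leftEnd φ)) f * g)) (endoTensor φ γ u j)) =
      actAux φ f ((tensSq φ).left ((γ j : Module.End K A) x) (u j))
        ((g : Module.End K A) y) := by
    rw [endoEval_right, endoEval_endoTensor φ γ u h, actAux_left]
    rfl
  have h1 := h 1 x
  simp only [one_mul] at h1
  rw [map_sum, Finset.sum_congr rfl fun j _ => hj j, ← LinearMap.sum_apply, ← map_sum, ← h1,
    actAux_tm, one_mul, endoEval_tm]

end

end DepthTwo

end

theorem mainTheorem2 {K A B : Type*} [CommRing K] [Ring A] [Ring B] [Algebra K A] [Algebra K B]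
    (φ : DepthTwo.AlgExt K B A) (hφ : DepthTwo.IsRightD2 φ) :
    Function.Injective (DepthTwo.rho φ) ∧
    DepthTwo.IsLeftD2 (DepthTwo.rho φ) ∧
    DepthTwo.IsLeftBalanced (DepthTwo.rho φ) ∧
    (∃ (n : ℕ) (γ : Fin n → DepthTwo.bimodEnd φ) (u : Fin n → DepthTwo.centralTensor φ),
      DepthTwo.IsRightD2Quasibase φ γ u) ∧
    ∀ (n : ℕ) (γ : Fin n → DepthTwo.bimodEnd φ) (u : Fin n → DepthTwo.centralTensor φ),
      DepthTwo.IsRightD2Quasibase φ γ u →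
      ∃ t : Fin n → DepthTwo.centralTensor (DepthTwo.rho φ),
        (∀ j, (t j : DepthTwo.TensSq (DepthTwo.rho φ)) = DepthTwo.endoTensor φ γ u j) ∧
        DepthTwo.IsLeftD2Quasibase (DepthTwo.rho φ) (fun j => DepthTwo.actEnd φ (u j)) t := by
  obtain ⟨n, γ, u, h⟩ := DepthTwo.exists_isRightD2Quasibase φ hφ
  refine ⟨DepthTwo.rho_injective φ,
    DepthTwo.isLeftD2_of_quasibase _ _ _ (DepthTwo.isLeftD2Quasibase_rho φ γ u h),
    DepthTwo.isLeftBalanced_rho φ, ⟨n, γ, u, h⟩, fun m γ' u' h' => ?_⟩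
  exact ⟨_, fun j => rfl, DepthTwo.isLeftD2Quasibase_rho φ γ' u' h'⟩
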